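/- Let $\Gamma$ be a finite tree with vertex set $V$, and let $F=\mathrm{Frac}(\mathbb Z[A_i : i\in V][X_i : i\in V])$, where all $A_i$, $X_i$ are algebraically independent. For $S\subseteq V$ let $$Y_S=\sum_{f}\ \prod_{i\in S}\frac{\widetilde X_{i,f(i)}}{X_i}\in F,\qquad \widetilde X_{i,i}=A_i,\quad \widetilde X_{i,k}=X_k\ (k\ne i),$$ where $f$ runs over the functions $f\colon S\to V$ such that $f(i)=i$ or $f(i)$ is adjacent to $i$ for every $i\in S$, and such that $f$ has no cycles other than fixed points. (These are the variables $Y_S$ of the graph LP algebra $\mathcal A_\Gamma$, written in the initial cluster; $Y_\emptyset=1$.) A set $\mathcal I$ of nonempty connected subsets of $V$ is a nested collection if any two members are disjoint or comparable under inclusion, and if for pairwise disjoint members $S_1,\dots,S_\ell$ the connected components of $S_1\cup\dots\cup S_\ell$ are exactly $S_1,\dots,S_\ell$. It is a maximal nested collection (on $V$) if moreover the union of its members is $V$ and no further subset of $V$ can be added to it so that it stays a nested collection. Fix a maximal nested collection $\mathcal I$. For $v\in V$ let $I_v$ be the smallest member of $\mathcal I$ containing $v$. Write $u<_{\mathcal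 I}w$ if $u\ne w$ and $u\in I_w$; this is a strict partial order. Let $\mathcal C_w$ be the set of vertices covered by $w$ in this order, and for $I\in\mathcal I$ let $m_{\mathcal I}(I)$ be the largest element of $I$. Let $[x,y]$ be the vertex set of the path in $\Gamma$ from $x$ to $y$. Fix $v\in V$, and let $a_1,\dots,a_r$ ($r\ge 0$) be the neighbours of $v$ with $a_i<_{\mathcal I}v$. For $1\le i\le r$, the members of $\mathcal I$ that contain $a_i$ but not $v$ form a chain $I^i_{c_i}\subsetneq I^i_{c_i-1}\subsetneq\dots\subsetneq I^i_1$, where $c_i$ is their number; put $I^i_{c_i+1}=\emptyset$ and $a^i_j=m_{\mathcal I}(I^i_j)$ for $1\le j\le c_i$. Define $$A^i_j=\begin{cases}\Big(\prod_{w\in\mathcal C_{a^i_j}\setminus\{a^i_{j+1}\}}Y_{I_w}\Big)\,Y_{I^i_{j+1}\setminus[v,a^i_j]}^{\,2}, & 1\le j<c_i,\\[4pt] \prod_{w\in\mathcal C_{a^i_{c_i}}}Y_{I_w}, & j=c_i.\end{cases}$$ Then for every choice of integers $1\le m_i\le c_i+1$ ($1\le i\le r$), with $J_{\mathbf m}=\{v\}\cup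 I^1_{m_1}\cup\dots\cup I^r_{m_r}$, $$Y_{J_{\mathbf m}}=Y_{J_{\mathbf m}\setminus\{v\}}\left(\frac{Y_{I_v}}{Y_{I^1_1}\cdots Y_{I^r_1}}+\sum_{i=1}^r\sum_{j=1}^{m_i-1}\frac{A^i_j}{Y_{I^i_j}\,Y_{I^i_{j+1}}}\right).$$ In particular (all $m_i=c_i+1$), $$Y_{\{v\}}=\frac{Y_{I_v}}{Y_{I^1_1}\cdots Y_{I^r_1}}+\sum_{i=1}^r\sum_{j=1}^{c_i}\frac{A^i_j}{Y_{I^i_j}\,Y_{I^i_{j+1}}}.$$ -/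

import Mathlib

namespace GraphLP

/-! ### The ambient field and the elements `Y_S` -/

/-- The field of rational functions in the cluster variables `X_i` over the coefficient ring
`R = ℤ[A_i : i ∈ V]`. -/
abbrev AmbientField (V : Type*) : Type _ := FractionRing (MvPolynomial V (MvPolynomial V ℤ))

/-- The frozen variable `A_i`. -/
noncomputable def varA {V : Type*} (i : V) : AmbientField V :=
  algebraMap (MvPolynomial V (MvPolynomial V ℤ)) (AmbientField V)
    (MvPolynomial.C (MvPolynomial.X i))

/-- The initial cluster variable `X_i`. -/
noncomputable def varX {V : Type*} (i : V) : AmbientField V :=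
  algebraMap (MvPolynomial V (MvPolynomial V ℤ)) (AmbientField V) (MvPolynomial.X i)

/-- The acyclic functions `S → V`: every `x ∈ S` is sent to itself or to a neighbour of it, and
the only cycles are fixed points. A function on `S` is represented by its extension to `V` that
is the identity off `S`; this neither creates nor destroys cycles of length at least two. -/
def IsAcyclicFun {V : Type*} (G : SimpleGraph V) (S : Finset V) (f : V → V) : Prop :=
  (∀ x ∉ S, f x = x) ∧ (∀ x ∈ S, f x = x ∨ G.Adj x (f x)) ∧
    ∀ x ∈ Function.periodicPts f, f x = x

open Classical in
/-- The element `Y_S` of the graph LP algebra: the sum over acyclic functions `f : S → V` of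
`∏_{i ∈ S} X̃_{f(i)} / X_i`, where `X̃_{f(i)}` is `A_i` if `f(i) = i` and `X_{f(i)}` otherwise. -/
noncomputable def Y {V : Type*} [Fintype V] (G : SimpleGraph V) (S : Finset V) : AmbientField V :=
  ∑ f ∈ Finset.univ.filter (fun f : V → V => IsAcyclicFun G S f),
    ∏ i ∈ S, (if f i = i then varA i else varX (f i)) / varX i

/-! ### Nested collections -/

/-- `S` is a (nonempty) connected vertex subset. -/
def IsConnectedSet {V : Type*} (G : SimpleGraph V) (S : Finset V) : Prop :=
  (G.induce (S : Set V)).Connected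

/-- `C` is a connected component of the vertex subset `U`: a maximal connected subset of it. -/
def IsComponent {V : Type*} (G : SimpleGraph V) (U C : Finset V) : Prop :=
  Maximal (fun D : Finset V => D ⊆ U ∧ IsConnectedSet G D) C

/-- Nested collections of vertex subsets. -/
structure IsNested {V : Type*} [DecidableEq V] (G : SimpleGraph V) (𝓘 : Finset (Finset V)) :
    Prop where
  connected : ∀ S ∈ 𝓘, IsConnectedSet G S
  laminar : ∀ S ∈ 𝓘, ∀ T ∈ 𝓘, S ⊆ T ∨ T ⊆ S ∨ Disjoint S T
  components : ∀ 𝓣 ⊆ 𝓘, (𝓣 : Set (Finset V)).PairwiseDisjoint id →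
    ∀ C : Finset V, IsComponent G (𝓣.biUnion id) C ↔ C ∈ 𝓣

/-- Maximal nested collections on a vertex subset `S`. -/
structure IsMaximalNestedOn {V : Type*} [DecidableEq V] (G : SimpleGraph V) (S : Finset V)
    (𝓘 : Finset (Finset V)) : Prop where
  nested : IsNested G 𝓘
  union_eq : 𝓘.biUnion id = S
  maximal : ∀ S' ⊆ S, IsNested G (insert S' 𝓘) → S' ∈ 𝓘

/-- `I_v`, the smallest member of `𝓘` containing `v` (as the intersection of all members
containing `v`; for a maximal nested collection on all vertices these form a nonempty chain). -/
def smallestSet {V : Type*} [Fintype V] [DecidableEq V] (𝓘 : Finset (Finset V)) (v : V) :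
    Finset V :=
  (𝓘.filter (fun I => v ∈ I)).inf id

/-- The strict order `i <_𝓘 j`, i.e. `i ≠ j` and `i ∈ I_j`. -/
def NLT {V : Type*} [Fintype V] [DecidableEq V] (𝓘 : Finset (Finset V)) (i j : V) : Prop :=
  i ≠ j ∧ i ∈ smallestSet 𝓘 j

/-- `w` is the largest element of `S` for `<_𝓘`. -/
def IsTop {V : Type*} [Fintype V] [DecidableEq V] (𝓘 : Finset (Finset V)) (S : Finset V)
    (w : V) : Prop :=
  w ∈ S ∧ ∀ u ∈ S, u = w ∨ NLT 𝓘 u w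

/-- `m_𝓘(S)`, the largest element of `S` for `<_𝓘` (used for nonempty connected `S` only). -/
noncomputable def topVertex {V : Type*} [Fintype V] [DecidableEq V] [Nonempty V]
    (𝓘 : Finset (Finset V)) (S : Finset V) : V :=
  Classical.epsilon (IsTop 𝓘 S)

open Classical in
/-- `𝓒_v`, the set of vertices covered by `v` for `<_𝓘`. -/
noncomputable def covered {V : Type*} [Fintype V] [DecidableEq V] (𝓘 : Finset (Finset V))
    (v : V) : Finset V :=
  Finset.univ.filter (fun w => NLT 𝓘 w v ∧ ∀ u, ¬ (NLT 𝓘 w u ∧ NLT 𝓘 u v))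

open Classical in
/-- `[x, y]`, the set of vertices on the path between `x` and `y` (unique in a tree). -/
noncomputable def pathSet {V : Type*} [Fintype V] (G : SimpleGraph V) (x y : V) : Finset V :=
  Finset.univ.filter (fun z => ∃ p : G.Walk x y, p.IsPath ∧ z ∈ p.support)

/-! ### The data attached to a vertex `v`

The neighbours `a_1, …, a_r` of `v` below `v` are used directly as the index set for `i`. -/

open Classical in
/-- The neighbours of `v` that are smaller than `v`. -/
noncomputable def lowerNbrs {V : Type*} [Fintype V] [DecidableEq V] (G : SimpleGraph V)
    (𝓘 : Finset (Finset V)) (v : V) : Finset V :=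
  Finset.univ.filter (fun a => G.Adj v a ∧ NLT 𝓘 a v)

/-- The members of `𝓘` that contain `a` but not `v`. -/
def chain {V : Type*} [DecidableEq V] (𝓘 : Finset (Finset V)) (v a : V) : Finset (Finset V) :=
  𝓘.filter (fun I => a ∈ I ∧ v ∉ I)

/-- `c_i`, for `a = a_i`. -/
def chainLength {V : Type*} [DecidableEq V] (𝓘 : Finset (Finset V)) (v a : V) : ℕ :=
  (chain 𝓘 v a).card

/-- `I^i_j`, for `a = a_i`: the `j`-th largest set of the chain of members of `𝓘` containing `a`
but not `v` (`j = 1, …, c_i`), i.e. the one that is contained in exactly `j` sets of the chain,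
itself included. It is empty for `j = c_i + 1`. -/
def chainSet {V : Type*} [DecidableEq V] (𝓘 : Finset (Finset V)) (v a : V) (j : ℕ) : Finset V :=
  ((chain 𝓘 v a).filter (fun I => ((chain 𝓘 v a).filter (fun K => I ⊆ K)).card = j)).biUnion id

/-- `a^i_j = m_𝓘(I^i_j)`, for `a = a_i` and `1 ≤ j ≤ c_i`. -/
noncomputable def chainVertex {V : Type*} [Fintype V] [DecidableEq V] (𝓘 : Finset (Finset V))
    (v a : V) (j : ℕ) : V :=
  haveI : Nonempty V := ⟨v⟩
  topVertex 𝓘 (chainSet 𝓘 v a j)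

/-- `A^i_j`, for `a = a_i` and `1 ≤ j ≤ c_i`. -/
noncomputable def chainCoeff {V : Type*} [Fintype V] [DecidableEq V] (G : SimpleGraph V)
    (𝓘 : Finset (Finset V)) (v a : V) (j : ℕ) : AmbientField V :=
  if j < chainLength 𝓘 v a then
    (∏ w ∈ covered 𝓘 (chainVertex 𝓘 v a j) \ {chainVertex 𝓘 v a (j + 1)},
        Y G (smallestSet 𝓘 w)) *
      Y G (chainSet 𝓘 v a (j + 1) \ pathSet G v (chainVertex 𝓘 v a j)) ^ 2
  else
    ∏ w ∈ covered 𝓘 (chainVertex 𝓘 v a j), Y G (smallestSet 𝓘 w)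

/-- `J_m = {v} ∪ I^1_{m_1} ∪ ⋯ ∪ I^r_{m_r}`. -/
noncomputable def setJ {V : Type*} [Fintype V] [DecidableEq V] (G : SimpleGraph V)
    (𝓘 : Finset (Finset V)) (v : V) (m : V → ℕ) : Finset V :=
  {v} ∪ (lowerNbrs G 𝓘 v).biUnion (fun a => chainSet 𝓘 v a (m a))

end GraphLP

/-!
In a tree, an acyclic function is one without two-cycles, and a two-cycle through adjacent `v` and
`a` has weight `X_a / X_v * X_v / X_a = 1`. Removing the two-cycles through `v` from the free choice
of a value at `v` therefore gives the continuant recursion (`Y_eq_sub`)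
`Y_S = Y_v Y_{S \ v} - ∑_a Y_{S \ {v, a}}`, over the neighbours `a` of `v` in `S`.
Two consequences carry the proof. `Y` is multiplicative over sets with no edge between them
(`Y_biUnion`), and for a path `[x, y]` in `S` with `x ≠ y` there is Euler's identity
(`minorDiff_of_isPath`) `Y_{S \ x} Y_{S \ y} - Y_S Y_{S \ {x, y}} = Y_{S \ [x, y]} ^ 2`.

In a maximal nested collection `w ↦ I_w` is a bijection onto the members, and `I_b \ b` is the
disjoint union, without edges in between, of the `I_w` for `w` covered by `b`. As `v` separates the
chain sets of different lower neighbours, the recursion at `v` reads (`Y_setJ`)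
`Y_J = Y_{J \ v} (Y_v - ∑_a Y_{I^a \ a} / Y_{I^a})` with `I^a` the chain set of `a` in `J`, the
summand being `0` if `I^a` is empty. For `J = I_v` this expresses `Y_v` through `Y_{I_v}`, and
Euler's identity shows that `A^a_j / (Y_{I^a_j} Y_{I^a_{j+1}})` is the drop of the ratio
`Y_{I^a \ a} / Y_{I^a}` from `I^a_j` to `I^a_{j+1}` (`deletionRatio_sub`), so that the sums over
`j` telescope.
-/

namespace GraphLP

section Acyclic

variable {V : Type*}

/-! ### Acyclic functions on a tree -/

lemma exists_walk_support_iterate {G : SimpleGraph V} {f : V → V}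
    (hf : ∀ x, f x = x ∨ G.Adj x (f x))
    (k : ℕ) (x : V) (hx : ∀ i < k, f (f^[i] x) ≠ f^[i] x) :
    ∃ p : G.Walk x (f^[k] x), p.support = (List.range (k + 1)).map (fun i => f^[i] x) := by
  induction k with
  | zero => exact ⟨.nil, by simp⟩
  | succ k ih =>
    obtain ⟨p, hp⟩ := ih fun i hi => hx i (by omega)
    have h : G.Adj (f^[k] x) (f^[k + 1] x) := by
      rw [Function.iterate_succ_apply']
      exact (hf _).resolve_left (hx k (by omega))
    refine ⟨p.concat h, ?_⟩
    rw [SimpleGraph.Walk.support_concat, hp, List.range_succ (n := k + 1)]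
    simp

/-- In a tree, the orbit of a periodic point that is not fixed has length two, since otherwise it
would trace a cycle of the graph. -/
lemma iterate_two_of_periodic {G : SimpleGraph V} (hG : G.IsAcyclic) {f : V → V}
    (hf : ∀ x, f x = x ∨ G.Adj x (f x)) {x : V} (hx : x ∈ Function.periodicPts f)
    (hne : f x ≠ x) : f (f x) = x := by
  obtain ⟨n, hn⟩ : ∃ n, Function.minimalPeriod f x = n + 1 :=
    Nat.exists_eq_succ_of_ne_zero (Function.minimalPeriod_pos_of_mem_periodicPts hx).ne'
  have hper : f^[n + 1] x = x := hn ▸ Function.iterate_minimalPeriod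
  have hinj : ∀ i < n + 1, ∀ j < n + 1, f^[i] x = f^[j] x → i = j := by
    intro i hi j hj h
    exact Function.iterate_injOn_Iio_minimalPeriod (f := f) (x := x)
      (by simpa [hn] using hi) (by simpa [hn] using hj) h
  have hnz : n ≠ 0 := by
    rintro rfl
    exact hne (by simpa using hper)
  obtain ⟨p, hp⟩ := exists_walk_support_iterate hf n x (by
    intro i hi h
    rw [← Function.iterate_succ_apply' f] at h
    have := hinj (i + 1) (by omega) i (by omega) h
    omega)
  have hpath : p.IsPath := by
    rw [SimpleGraph.Walk.isPath_def, hp]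
    refine List.Nodup.map_on (fun i hi j hj h => ?_) List.nodup_range
    exact hinj i (by simpa using hi) j (by simpa using hj) h
  have hlast : f (f^[n] x) = x := by rw [← Function.iterate_succ_apply' f]; exact hper
  have hadj : G.Adj x (f^[n] x) := by
    have h := hf (f^[n] x)
    rw [hlast] at h
    rcases h with h | h
    · exact absurd (hinj n (by omega) 0 (by omega) (by simpa using h.symm)) hnz
    · exact h.symm
  have heq : p = hadj.toWalk :=
    congrArg Subtype.val ((hG.subsingleton_path _ _).elim ⟨p, hpath⟩
      ⟨hadj.toWalk, by simp [hadj.ne]⟩)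
  have hlen : n = 1 := by
    have h1 : p.support.length = 2 := by rw [heq]; simp
    rw [hp] at h1
    simpa using h1
  subst hlen
  simpa using hper

/-- In a tree, acyclic functions are the ones without two-cycles. -/
lemma isAcyclicFun_iff {G : SimpleGraph V} (hG : G.IsAcyclic) {S : Finset V} {f : V → V} :
    IsAcyclicFun G S f ↔ (∀ x ∉ S, f x = x) ∧ (∀ x ∈ S, f x = x ∨ G.Adj x (f x)) ∧
      ∀ x, f (f x) = x → f x = x := by
  refine and_congr_right fun h1 => and_congr_right fun h2 => ⟨fun h x hx => h x ?_, ?_⟩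
  · exact Function.mk_mem_periodicPts (n := 2) (by norm_num) hx
  · intro h x hx
    by_contra hne
    refine hne (h x (iterate_two_of_periodic hG (fun y => ?_) hx hne))
    by_cases hy : y ∈ S
    · exact h2 y hy
    · exact Or.inl (h1 y hy)

/-! ### The recursion for `Y` -/

open Classical in
/-- The factor that an acyclic function with value `b` at `i` contributes to `Y`. -/
noncomputable def stepWeight (i b : V) : AmbientField V :=
  (if b = i then varA i else varX b) / varX i

lemma varX_ne_zero (i : V) : varX i ≠ 0 := by
  rw [varX, Ne, FaithfulSMul.algebraMap_eq_zero_iff]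
  exact MvPolynomial.X_ne_zero i

lemma stepWeight_mul_stepWeight {a b : V} (h : a ≠ b) : stepWeight a b * stepWeight b a = 1 := by
  have := varX_ne_zero a
  have := varX_ne_zero b
  rw [stepWeight, stepWeight, if_neg h, if_neg h.symm]
  field_simp

variable [Fintype V]

open Classical in
/-- The acyclic functions on `S`. -/
noncomputable def acyclicFuns (G : SimpleGraph V) (S : Finset V) : Finset (V → V) :=
  Finset.univ.filter (fun f : V → V => IsAcyclicFun G S f)

lemma mem_acyclicFuns {G : SimpleGraph V} (hG : G.IsAcyclic) {S : Finset V} {f : V → V} :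
    f ∈ acyclicFuns G S ↔ (∀ x ∉ S, f x = x) ∧ (∀ x ∈ S, f x = x ∨ G.Adj x (f x)) ∧
      ∀ x, f (f x) = x → f x = x := by
  simp [acyclicFuns, isAcyclicFun_iff hG]

lemma Y_eq_sum (G : SimpleGraph V) (S : Finset V) :
    Y G S = ∑ f ∈ acyclicFuns G S, ∏ i ∈ S, stepWeight i (f i) := by
  simp only [Y, acyclicFuns, stepWeight]

lemma id_mem_acyclicFuns (G : SimpleGraph V) (S : Finset V) : id ∈ acyclicFuns G S := by
  simp only [acyclicFuns, Finset.mem_filter, Finset.mem_univ, true_and]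
  exact ⟨fun _ _ => rfl, fun _ _ => Or.inl rfl, fun _ _ => rfl⟩

/-- After clearing denominators, `Y_S` becomes a polynomial whose value at the point with all
coordinates `1` is the number of acyclic functions on `S`, which is positive. -/
lemma Y_ne_zero (G : SimpleGraph V) (S : Finset V) : Y G S ≠ 0 := by
  classical
  let R := MvPolynomial V (MvPolynomial V ℤ)
  let P : R := ∑ f ∈ acyclicFuns G S, ∏ i ∈ S,
    (if f i = i then MvPolynomial.C (MvPolynomial.X i) else MvPolynomial.X (f i))
  have hP : algebraMap R (AmbientField V) P = Y G S * ∏ i ∈ S, varX i := by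
    rw [Y_eq_sum, Finset.sum_mul, map_sum]
    refine Finset.sum_congr rfl fun f _ => ?_
    rw [← Finset.prod_mul_distrib, map_prod]
    refine Finset.prod_congr rfl fun i _ => ?_
    rw [stepWeight, div_mul_cancel₀ _ (varX_ne_zero i), apply_ite (algebraMap R (AmbientField V))]
    simp only [varA, varX, R]
  let ev : R →+* ℤ := MvPolynomial.eval₂Hom (MvPolynomial.eval fun _ => (1 : ℤ)) fun _ => 1
  have hev : ev P = (acyclicFuns G S).card := by
    rw [map_sum, Finset.card_eq_sum_ones, Nat.cast_sum]
    refine Finset.sum_congr rfl fun f _ => ?_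
    rw [map_prod, Nat.cast_one]
    refine Finset.prod_eq_one fun i _ => ?_
    split_ifs
    · exact (MvPolynomial.eval₂Hom_C _ _ _).trans (MvPolynomial.eval_X i)
    · exact MvPolynomial.eval₂Hom_X' _ _ _
  intro h0
  rw [h0, zero_mul, FaithfulSMul.algebraMap_eq_zero_iff] at hP
  rw [hP, map_zero] at hev
  have : (acyclicFuns G S).card = 0 := by exact_mod_cast hev.symm
  rw [Finset.card_eq_zero] at this
  exact absurd (id_mem_acyclicFuns G S) (by simp [this])

@[simp]
lemma Y_empty (G : SimpleGraph V) : Y G ∅ = 1 := by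
  have : acyclicFuns G ∅ = {id} := by
    ext f
    simp only [Finset.mem_singleton]
    refine ⟨fun h => ?_, fun h => h ▸ id_mem_acyclicFuns G ∅⟩
    simp only [acyclicFuns, Finset.mem_filter, Finset.mem_univ, true_and] at h
    exact funext fun x => h.1 x (by simp)
  simp [Y_eq_sum, this]

variable [DecidableEq V]

/-- Freely combining a value at `v` with an acyclic function on `S \ {v}` gives either an acyclic
function on `S`, or a two-cycle through `v` and a neighbour `a`, whose weight is `1`, together with
an acyclic function on `S \ {v, a}`. -/
lemma Y_singleton_mul {G : SimpleGraph V} [DecidableRel G.Adj] (hG : G.IsAcyclic) {S : Finset V}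
    {v : V} (hv : v ∈ S) :
    Y G {v} * Y G (S.erase v) =
      Y G S + ∑ a ∈ S.erase v with G.Adj v a, Y G ((S.erase v).erase a) := by
  classical
  simp only [Y_eq_sum G]
  rw [Finset.sum_mul_sum, ← Finset.sum_product',
    ← Finset.sum_filter_not_add_sum_filter _ fun p : (V → V) × (V → V) =>
      p.1 v ≠ v ∧ p.2 (p.1 v) = v]
  congr 1
  -- Without the two-cycle, the combined function is acyclic on `S`.
  · refine Finset.sum_bij' (fun p _ => Function.update p.2 v (p.1 v))
      (fun f _ => (Function.update id v (f v), Function.update f v v)) ?_ ?_ ?_ ?_ ?_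
    all_goals simp only [Finset.mem_filter, Finset.mem_product, mem_acyclicFuns hG,
      Finset.mem_singleton, Finset.mem_erase]
    · rintro ⟨h, g⟩ ⟨⟨⟨h1, h2, h3⟩, g1, g2, g3⟩, hh⟩
      dsimp only at *
      refine ⟨?_, ?_, ?_⟩ <;> intro x <;> simp only [Function.update_apply] <;> grind
    · rintro f ⟨f1, f2, f3⟩
      refine ⟨⟨⟨?_, ?_, ?_⟩, ?_, ?_, ?_⟩, ?_⟩
      iterate 6 (intro x; simp only [Function.update_apply, id]; grind)
      simp only [Function.update_apply, id]; grind
    · rintro ⟨h, g⟩ ⟨⟨⟨h1, h2, h3⟩, g1, g2, g3⟩, hh⟩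
      dsimp only at *
      refine Prod.ext (funext fun x => ?_) (funext fun x => ?_) <;>
        simp only [Function.update_apply, id] <;> grind
    · rintro f ⟨f1, f2, f3⟩
      simp
    · rintro ⟨h, g⟩ -
      rw [Finset.prod_singleton, ← Finset.mul_prod_erase S _ hv]
      simp only [Function.update_self]
      congr 1
      refine Finset.prod_congr rfl fun i hi => ?_
      rw [Function.update_of_ne (Finset.ne_of_mem_erase hi)]
  -- With the two-cycle through `v` and `a`, the values at `v` and `a` are forced.
  · rw [Finset.sum_sigma']
    refine Finset.sum_bij' (fun p _ => ⟨p.1 v, Function.update p.2 (p.1 v) (p.1 v)⟩)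
      (fun q _ => (Function.update id v q.1, Function.update q.2 q.1 v)) ?_ ?_ ?_ ?_ ?_
    all_goals simp only [Finset.mem_filter, Finset.mem_product, mem_acyclicFuns hG,
      Finset.mem_singleton, Finset.mem_erase, Finset.mem_sigma]
    · rintro ⟨h, g⟩ ⟨⟨⟨h1, h2, h3⟩, g1, g2, g3⟩, hh⟩
      dsimp only at *
      refine ⟨?_, ?_, ?_, ?_⟩
      · grind
      iterate 3 (intro x; simp only [Function.update_apply]; grind)
    · rintro ⟨a, f⟩ ⟨ha, f1, f2, f3⟩
      dsimp only at *
      have := ha.2.symm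
      refine ⟨⟨⟨?_, ?_, ?_⟩, ?_, ?_, ?_⟩, ?_⟩
      iterate 6 (intro x; simp only [Function.update_apply, id]; grind)
      simp only [Function.update_apply, id]; grind
    · rintro ⟨h, g⟩ ⟨⟨⟨h1, h2, h3⟩, g1, g2, g3⟩, hh⟩
      dsimp only at *
      refine Prod.ext (funext fun x => ?_) (funext fun x => ?_) <;>
        simp only [Function.update_apply, id] <;> grind
    · rintro ⟨a, f⟩ ⟨ha, f1, f2, f3⟩
      dsimp only at *
      have : f a = a := f1 a (by simp)
      simp [this]
    · rintro ⟨h, g⟩ ⟨⟨⟨h1, h2, h3⟩, g1, g2, g3⟩, hh⟩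
      dsimp only at *
      have hmem : h v ∈ S.erase v := by
        by_contra hcon
        have := g1 (h v) (by simpa using hcon)
        grind
      rw [Finset.prod_singleton, ← Finset.mul_prod_erase (S.erase v) _ hmem, ← mul_assoc, hh.2,
        stepWeight_mul_stepWeight (Ne.symm hh.1), one_mul]
      refine Finset.prod_congr rfl fun i hi => ?_
      rw [Function.update_of_ne (Finset.ne_of_mem_erase hi)]

/-- The continuant recursion, expanding `Y_S` at the vertex `v`. -/
lemma Y_eq_sub {G : SimpleGraph V} [DecidableRel G.Adj] (hG : G.IsAcyclic) {S : Finset V}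
    {v : V} (hv : v ∈ S) :
    Y G S = Y G {v} * Y G (S.erase v) -
      ∑ a ∈ S.erase v with G.Adj v a, Y G ((S.erase v).erase a) := by
  rw [Y_singleton_mul hG hv, add_sub_cancel_right]

end Acyclic

section Continuant

variable {V : Type*} [Fintype V] [DecidableEq V]

/-! ### Multiplicativity and the path identity -/

lemma Y_union {G : SimpleGraph V} (hG : G.IsAcyclic) {S T : Finset V} (hd : Disjoint S T)
    (hn : ∀ x ∈ S, ∀ y ∈ T, ¬ G.Adj x y) : Y G (S ∪ T) = Y G S * Y G T := by
  classical
  induction S using Finset.strongInduction with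
  | H S ih =>
  obtain rfl | ⟨v, hv⟩ := S.eq_empty_or_nonempty
  · simp
  have hvT : v ∉ T := Finset.disjoint_left.1 hd hv
  have hsub : ∀ S' ⊂ S, Y G (S' ∪ T) = Y G S' * Y G T := fun S' h =>
    ih S' h (hd.mono_left h.subset) fun x hx => hn x (h.subset hx)
  have hv1 : (S ∪ T).erase v = S.erase v ∪ T := by grind
  have hv2 : ((S.erase v ∪ T).filter fun a => G.Adj v a) =
      (S.erase v).filter fun a => G.Adj v a := by
    grind
  rw [Y_eq_sub hG (Finset.mem_union_left T hv), Y_eq_sub hG hv, hv1, hv2,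
    hsub _ (Finset.erase_ssubset hv), sub_mul, Finset.sum_mul, mul_assoc]
  congr 1
  refine Finset.sum_congr rfl fun a ha => ?_
  have hva := hn v hv a
  rw [← hsub _ ((Finset.erase_subset _ _).trans_ssubset (Finset.erase_ssubset hv))]
  congr 1
  grind

lemma Y_biUnion {G : SimpleGraph V} (hG : G.IsAcyclic) {ι : Type*} [DecidableEq ι] (s : Finset ι)
    (B : ι → Finset V)
    (hd : ∀ i ∈ s, ∀ j ∈ s, i ≠ j → Disjoint (B i) (B j))
    (hn : ∀ i ∈ s, ∀ j ∈ s, i ≠ j → ∀ x ∈ B i, ∀ y ∈ B j, ¬ G.Adj x y) :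
    Y G (s.biUnion B) = ∏ i ∈ s, Y G (B i) := by
  induction s using Finset.induction_on with
  | empty => simp
  | insert i s hi ih =>
    have hne : ∀ j ∈ s, i ≠ j := fun j hj h => hi (h ▸ hj)
    rw [Finset.biUnion_insert, Finset.prod_insert hi, Y_union hG, ih]
    · exact fun a ha b hb => hd a (by simp [ha]) b (by simp [hb])
    · exact fun a ha b hb => hn a (by simp [ha]) b (by simp [hb])
    · rw [Finset.disjoint_biUnion_right]
      exact fun j hj => hd i (by simp) j (by simp [hj]) (hne j hj)
    · intro x hx y hy
      obtain ⟨j, hj, hy⟩ := Finset.mem_biUnion.1 hy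
      exact hn i (by simp) j (by simp [hj]) (hne j hj) x hx y hy

/-- The minor-type expression `Y_{S \ x} Y_{S \ y} - Y_S Y_{S \ {x, y}}`, where the second term is
dropped when `x = y`. -/
noncomputable def minorDiff (G : SimpleGraph V) (S : Finset V) (x y : V) : AmbientField V :=
  Y G (S.erase x) * Y G (S.erase y) - if x = y then 0 else Y G S * Y G ((S.erase x).erase y)

/-- The recursion at `x`, applied to both `Y_S` and `Y_{S \ y}`: the terms with `Y_{{x}}` cancel. -/
lemma minorDiff_eq_sum {G : SimpleGraph V} [DecidableRel G.Adj] (hG : G.IsAcyclic) {S : Finset V}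
    {x y : V} (hx : x ∈ S) (hxy : x ≠ y) :
    minorDiff G S x y = ∑ z ∈ S.erase x with G.Adj x z, minorDiff G (S.erase x) z y := by
  have h1 := Y_eq_sub hG hx
  have h2 := Y_eq_sub hG (show x ∈ S.erase y by grind)
  have h3 : (S.erase y).erase x = (S.erase x).erase y := Finset.erase_right_comm
  have h4 : ∑ a ∈ (S.erase y).erase x with G.Adj x a, Y G (((S.erase y).erase x).erase a) =
      ∑ a ∈ S.erase x with G.Adj x a,
        if a = y then 0 else Y G (((S.erase x).erase a).erase y) := by
    rw [h3, Finset.sum_ite, Finset.sum_const_zero, zero_add]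
    refine Finset.sum_congr (by grind) fun a _ => by rw [Finset.erase_right_comm]
  rw [h4, h3] at h2
  simp only [minorDiff, if_neg hxy, Finset.sum_sub_distrib, ← Finset.sum_mul]
  rw [h1, h2]
  have h5 : ∀ a, (if a = y then 0 else Y G (S.erase x) * Y G (((S.erase x).erase a).erase y)) =
      Y G (S.erase x) * if a = y then 0 else Y G (((S.erase x).erase a).erase y) := by
    intro a; split_ifs <;> simp
  simp only [h5, ← Finset.mul_sum]
  ring

/-- The right-hand side of `minorDiff_eq_sum` only follows walks inside `S` starting at `x`, so it
vanishes in the end if none of them reaches `y`. -/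
lemma minorDiff_eq_zero {G : SimpleGraph V} (hG : G.IsAcyclic) {S : Finset V}
    {x y : V} (hx : x ∈ S) (h : ¬ ∃ p : G.Walk x y, ∀ z ∈ p.support, z ∈ S) :
    minorDiff G S x y = 0 := by
  classical
  induction S using Finset.strongInduction generalizing x with
  | H S ih =>
  have hxy : x ≠ y := by
    rintro rfl
    exact h ⟨.nil, by simpa using hx⟩
  rw [minorDiff_eq_sum hG hx hxy]
  refine Finset.sum_eq_zero fun z hz => ?_
  rw [Finset.mem_filter] at hz
  refine ih _ (Finset.erase_ssubset hx) hz.1 ?_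
  rintro ⟨p, hp⟩
  refine h ⟨.cons hz.2 p, fun u hu => ?_⟩
  rw [SimpleGraph.Walk.support_cons, List.mem_cons] at hu
  rcases hu with rfl | hu
  · exact hx
  · exact Finset.mem_of_mem_erase (hp u hu)

/-- The tree version of Euler's continuant identity. Expanding at the first vertex `x` of the path
leaves one term for each neighbour of `x`, and all of them vanish except the one for the next vertex
of the path, because the other neighbours are separated from the end of the path. -/
lemma minorDiff_of_isPath {G : SimpleGraph V} (hG : G.IsAcyclic) {S : Finset V}
    {x y : V} (p : G.Walk x y) (hp : p.IsPath) (hS : ∀ z ∈ p.support, z ∈ S) :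
    minorDiff G S x y = Y G (S \ p.support.toFinset) ^ 2 := by
  classical
  induction p generalizing S with
  | nil => simp [minorDiff, sq, Finset.erase_eq]
  | @cons x e y hadj q ih =>
    rw [SimpleGraph.Walk.cons_isPath_iff] at hp
    have hxy : x ≠ y := fun h => hp.2 (h ▸ q.end_mem_support)
    have hx : x ∈ S := hS x (by simp)
    have hq : ∀ z ∈ q.support, z ∈ S.erase x := fun z hz =>
      Finset.mem_erase.2 ⟨fun h => hp.2 (h ▸ hz), hS z (by simp [hz])⟩
    rw [minorDiff_eq_sum hG hx hxy, Finset.sum_eq_single e, ih hp.1 hq]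
    · congr 2
      ext u
      simp only [Finset.mem_sdiff, Finset.mem_erase, List.mem_toFinset,
        SimpleGraph.Walk.support_cons, List.mem_cons]
      tauto
    · intro z hz hze
      rw [Finset.mem_filter] at hz
      refine minorDiff_eq_zero hG hz.1 ?_
      rintro ⟨r, hr⟩
      have hr' : x ∉ r.bypass.support := fun h =>
        (Finset.mem_erase.1 (hr x (r.support_bypass_subset_support h))).1 rfl
      have h := congrArg (fun P : G.Path x y => P.1.snd) ((hG.subsingleton_path x y).elim
        ⟨.cons hadj q, (SimpleGraph.Walk.cons_isPath_iff _ _).2 hp⟩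
        ⟨.cons hz.2 r.bypass, (SimpleGraph.Walk.cons_isPath_iff _ _).2 ⟨r.bypass_isPath, hr'⟩⟩)
      exact hze (by simpa using h.symm)
    · intro h
      exact absurd (Finset.mem_filter.2 ⟨hq e (by simp), hadj⟩) h

end Continuant

/-! ### Connected sets and components -/

section Connected

variable {V : Type*} {G : SimpleGraph V}

lemma IsConnectedSet.nonempty {S : Finset V} (h : IsConnectedSet G S) : S.Nonempty := by
  obtain ⟨x⟩ := SimpleGraph.Connected.nonempty h
  exact ⟨x, x.2⟩

lemma isConnectedSet_singleton (x : V) : IsConnectedSet G {x} := by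
  have : Nonempty (({x} : Finset V) : Set V) := ⟨⟨x, by simp⟩⟩
  refine SimpleGraph.Connected.mk ?_
  rintro ⟨a, ha⟩ ⟨b, hb⟩
  simp only [Finset.coe_singleton, Set.mem_singleton_iff] at ha hb
  subst ha hb
  exact SimpleGraph.Reachable.refl _

lemma IsConnectedSet.exists_walk {S : Finset V} (h : IsConnectedSet G S) {x y : V} (hx : x ∈ S)
    (hy : y ∈ S) : ∃ p : G.Walk x y, ∀ z ∈ p.support, z ∈ S := by
  obtain ⟨p⟩ := SimpleGraph.Connected.preconnected h ⟨x, hx⟩ ⟨y, hy⟩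
  refine ⟨p.map (SimpleGraph.Embedding.induce (S : Set V)).toHom, fun z hz => ?_⟩
  replace hz := (SimpleGraph.Walk.support_map _ p) ▸ hz
  obtain ⟨u, -, rfl⟩ := List.mem_map.1 hz
  exact u.2

/-- A connected set cannot be left without crossing an edge. -/
lemma IsConnectedSet.exists_adj {S : Finset V} (h : IsConnectedSet G S) {M : Finset V} {x y : V}
    (hx : x ∈ S) (hxM : x ∈ M) (hy : y ∈ S) (hyM : y ∉ M) :
    ∃ u ∈ S, ∃ w ∈ S, u ∈ M ∧ w ∉ M ∧ G.Adj u w := by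
  obtain ⟨p, hp⟩ := h.exists_walk hx hy
  obtain ⟨d, hd, h1, h2⟩ := p.exists_boundary_dart (M : Set V) hxM hyM
  exact ⟨d.fst, hp _ (p.dart_fst_mem_support_of_mem_darts hd), d.snd,
    hp _ (p.dart_snd_mem_support_of_mem_darts hd), h1, h2, d.adj⟩

lemma exists_isComponent {U : Finset V} {y : V} (hy : y ∈ U) : ∃ C, IsComponent G U C ∧ y ∈ C := by
  have hfin : {D : Finset V | D ⊆ U ∧ IsConnectedSet G D}.Finite :=
    U.powerset.finite_toSet.subset fun D hD => Finset.mem_coe.2 (Finset.mem_powerset.2 hD.1)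
  obtain ⟨C, hle, hC⟩ := hfin.exists_le_maximal (a := {y})
    ⟨Finset.singleton_subset_iff.2 hy, isConnectedSet_singleton y⟩
  exact ⟨C, hC, hle (by simp)⟩

variable [DecidableEq V]

lemma IsConnectedSet.union_of_adj {S T : Finset V} (hS : IsConnectedSet G S)
    (hT : IsConnectedSet G T) {x y : V} (hx : x ∈ S) (hy : y ∈ T) (h : G.Adj x y) :
    IsConnectedSet G (S ∪ T) := by
  rw [IsConnectedSet, Finset.coe_union]
  exact SimpleGraph.connected_induce_union hS.preconnected hT.preconnected hx hy h

lemma IsConnectedSet.union_of_mem {S T : Finset V} (hS : IsConnectedSet G S)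
    (hT : IsConnectedSet G T) {x : V} (hx : x ∈ S) (hy : x ∈ T) :
    IsConnectedSet G (S ∪ T) := by
  rw [IsConnectedSet, Finset.coe_union]
  exact SimpleGraph.induce_union_connected hS.preconnected hT.preconnected ⟨x, hx, hy⟩

lemma IsComponent.subset_of_union {U C T : Finset V} (hC : IsComponent G U C) (hT : T ⊆ U)
    (h : IsConnectedSet G (C ∪ T)) : T ⊆ C :=
  Finset.subset_union_right.trans
    (hC.2 ⟨Finset.union_subset hC.1.1 hT, h⟩ Finset.subset_union_left)

/-- In an acyclic graph, a connected set avoiding `v` contains at most one neighbour of `v`. -/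
lemma IsConnectedSet.eq_of_adj (hG : G.IsAcyclic) {T : Finset V} (hT : IsConnectedSet G T)
    {v a b : V} (hv : v ∉ T) (ha : a ∈ T) (hb : b ∈ T) (hva : G.Adj v a) (hvb : G.Adj v b) :
    a = b := by
  obtain ⟨p, hp⟩ := hT.exists_walk ha hb
  have hp' : v ∉ p.bypass.support := fun h => hv (hp v (p.support_bypass_subset_support h))
  have h := congrArg (fun P : G.Path v b => P.1.snd) ((hG.subsingleton_path v b).elim
    ⟨.cons hva p.bypass, (SimpleGraph.Walk.cons_isPath_iff _ _).2 ⟨p.bypass_isPath, hp'⟩⟩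
    ⟨hvb.toWalk, by simp [hvb.ne]⟩)
  simpa using h

/-! ### Nested collections -/

lemma IsNested.not_adj {𝓘 : Finset (Finset V)} (h : IsNested G 𝓘) {S T : Finset V} (hS : S ∈ 𝓘)
    (hT : T ∈ 𝓘) (hd : Disjoint S T) {x y : V} (hx : x ∈ S) (hy : y ∈ T) : ¬ G.Adj x y := by
  intro hxy
  have hcomp := h.components {S, T} (by grind) (by
    intro A hA B hB hAB
    simp only [Finset.coe_insert, Finset.coe_singleton, Set.mem_insert_iff,
      Set.mem_singleton_iff] at hA hB
    rcases hA with rfl | rfl <;> rcases hB with rfl | rfl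
    · exact absurd rfl hAB
    · exact hd
    · exact hd.symm
    · exact absurd rfl hAB) (S ∪ T)
  have hU : ({S, T} : Finset (Finset V)).biUnion id = S ∪ T := by simp
  rw [hU] at hcomp
  have hmem := hcomp.1
    ⟨⟨subset_rfl, (h.connected S hS).union_of_adj (h.connected T hT) hx hy hxy⟩, fun D hD _ => hD.1⟩
  have := Finset.disjoint_left.1 hd
  have hyS : y ∉ S := fun h => this h hy
  have hxT : x ∉ T := this hx
  rw [Finset.mem_insert, Finset.mem_singleton] at hmem
  rcases hmem with h' | h'
  · exact hyS (h' ▸ Finset.mem_union_right S hy)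
  · exact hxT (h' ▸ Finset.mem_union_left T hx)

/-- The condition on components in the definition of a nested collection amounts to the absence of
edges between disjoint members. -/
lemma IsNested.of_not_adj {𝓘 : Finset (Finset V)} (hc : ∀ S ∈ 𝓘, IsConnectedSet G S)
    (hl : ∀ S ∈ 𝓘, ∀ T ∈ 𝓘, S ⊆ T ∨ T ⊆ S ∨ Disjoint S T)
    (hn : ∀ S ∈ 𝓘, ∀ T ∈ 𝓘, Disjoint S T → ∀ x ∈ S, ∀ y ∈ T, ¬ G.Adj x y) : IsNested G 𝓘 := by
  refine ⟨hc, hl, fun 𝓣 h𝓣 hd C => ?_⟩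
  have key : ∀ T ∈ 𝓣, IsComponent G (𝓣.biUnion id) T := by
    intro T hT
    refine ⟨⟨Finset.subset_biUnion_of_mem id hT, hc T (h𝓣 hT)⟩, fun D hD hTD y hy => ?_⟩
    by_contra hyT
    obtain ⟨x, hx⟩ := (hc T (h𝓣 hT)).nonempty
    obtain ⟨u, -, w, hw, huT, hwT, hadj⟩ := hD.2.exists_adj (hTD hx) hx hy hyT
    obtain ⟨T', hT', hwT'⟩ := Finset.mem_biUnion.1 (hD.1 hw)
    have hne : T ≠ T' := fun h => hwT (h ▸ hwT')
    exact hn T (h𝓣 hT) T' (h𝓣 hT') (hd hT hT' hne) u huT w hwT' hadj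
  refine ⟨fun hC => ?_, key C⟩
  obtain ⟨x, hx⟩ := hC.1.2.nonempty
  obtain ⟨T, hT, hxT⟩ := Finset.mem_biUnion.1 (hC.1.1 hx)
  have hTC : T ⊆ C := hC.subset_of_union (key T hT).1.1
    (hC.1.2.union_of_mem (hc T (h𝓣 hT)) hx hxT)
  exact (hTC.antisymm ((key T hT).2 hC.1 hTC)) ▸ hT

end Connected

section Nested

variable {V : Type*} [Fintype V] [DecidableEq V] {G : SimpleGraph V} {𝓘 : Finset (Finset V)}

lemma mem_smallestSet (𝓘 : Finset (Finset V)) (v : V) : v ∈ smallestSet 𝓘 v := by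
  have : ({v} : Finset V) ≤ smallestSet 𝓘 v := Finset.le_inf fun I hI => by
    simpa using (Finset.mem_filter.1 hI).2
  exact this (by simp)

lemma smallestSet_subset {I : Finset V} (hI : I ∈ 𝓘) {v : V} (hv : v ∈ I) : smallestSet 𝓘 v ⊆ I :=
  Finset.inf_le (f := id) (Finset.mem_filter.2 ⟨hI, hv⟩)

lemma IsMaximalNestedOn.smallestSet_mem (h : IsMaximalNestedOn G Finset.univ 𝓘) (v : V) :
    smallestSet 𝓘 v ∈ 𝓘 := by
  have hv : v ∈ 𝓘.biUnion id := h.union_eq ▸ Finset.mem_univ v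
  obtain ⟨I₀, hI₀, hvI₀⟩ := Finset.mem_biUnion.1 hv
  obtain ⟨I, hI, hmin⟩ := Finset.exists_min_image (𝓘.filter fun I => v ∈ I) Finset.card
    ⟨I₀, Finset.mem_filter.2 ⟨hI₀, hvI₀⟩⟩
  rw [Finset.mem_filter] at hI
  have : smallestSet 𝓘 v = I := by
    refine (smallestSet_subset hI.1 hI.2).antisymm (Finset.le_inf fun K hK => ?_)
    have hcard := hmin K hK
    rw [Finset.mem_filter] at hK
    rcases h.nested.laminar I hI.1 K hK.1 with h' | h' | h'
    · exact h'
    · exact (Finset.eq_of_subset_of_card_le h' hcard).ge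
    · exact absurd hK.2 (Finset.disjoint_left.1 h' hI.2)
  exact this ▸ hI.1

/-- Otherwise take a maximal proper submember `M` of `I` and an edge of `I` leaving `M`; the
smallest member containing the other end of this edge contradicts laminarity, maximality of `M`, or
the absence of edges between disjoint members. -/
lemma IsMaximalNestedOn.exists_smallestSet_eq (h : IsMaximalNestedOn G Finset.univ 𝓘)
    {I : Finset V} (hI : I ∈ 𝓘) : ∃ w, smallestSet 𝓘 w = I := by
  by_contra! hne
  have hss : ∀ u ∈ I, smallestSet 𝓘 u ⊂ I := fun u hu =>
    (smallestSet_subset hI hu).ssubset_of_ne (hne u)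
  obtain ⟨u, hu⟩ := (h.nested.connected I hI).nonempty
  obtain ⟨M, hM, hmax⟩ := Finset.exists_max_image (𝓘.filter fun M => M ⊂ I) Finset.card
    ⟨_, Finset.mem_filter.2 ⟨h.smallestSet_mem u, hss u hu⟩⟩
  rw [Finset.mem_filter] at hM
  obtain ⟨x, hx⟩ := (h.nested.connected M hM.1).nonempty
  obtain ⟨y, hy, hyM⟩ := Finset.exists_of_ssubset hM.2
  obtain ⟨s, -, t, ht, hsM, htM, hadj⟩ :=
    (h.nested.connected I hI).exists_adj (hM.2.subset hx) hx hy hyM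
  have htK := mem_smallestSet 𝓘 t
  have hcard := hmax _ (Finset.mem_filter.2 ⟨h.smallestSet_mem t, hss t ht⟩)
  rcases h.nested.laminar M hM.1 _ (h.smallestSet_mem t) with h' | h' | h'
  · exact htM ((Finset.eq_of_subset_of_card_le h' hcard).ge htK)
  · exact htM (h' htK)
  · exact h.nested.not_adj hM.1 (h.smallestSet_mem t) h' hsM htK hadj

/-- If `I_x = I_y` with `x ≠ y`, then the component of `I_x \ x` containing `y` could be added to
the collection. -/
lemma IsMaximalNestedOn.smallestSet_injective (h : IsMaximalNestedOn G Finset.univ 𝓘) :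
    Function.Injective (smallestSet 𝓘) := by
  intro x y hxy
  by_contra hne
  have hI := h.smallestSet_mem x
  have hxI := mem_smallestSet 𝓘 x
  obtain ⟨C, hC, hyC⟩ := exists_isComponent (G := G) (U := (smallestSet 𝓘 x).erase x) (y := y)
    (Finset.mem_erase.2 ⟨Ne.symm hne, hxy ▸ mem_smallestSet 𝓘 y⟩)
  have hCI : C ⊆ smallestSet 𝓘 x := hC.1.1.trans (Finset.erase_subset _ _)
  have hconn := h.nested.connected
  -- A proper submember of `I_x` avoids `x`, hence lies in a single component of `I_x \ x`.
  have hsub : ∀ T ∈ 𝓘, ¬ smallestSet 𝓘 x ⊆ T → T ⊆ smallestSet 𝓘 x →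
      T ⊆ (smallestSet 𝓘 x).erase x := fun T hT h1 h2 u hu =>
    Finset.mem_erase.2 ⟨fun h' => h1 (smallestSet_subset hT (h' ▸ hu)), h2 hu⟩
  have hlam : ∀ T ∈ 𝓘, C ⊆ T ∨ T ⊆ C ∨ Disjoint C T := by
    intro T hT
    by_cases hIT : smallestSet 𝓘 x ⊆ T
    · exact Or.inl (hCI.trans hIT)
    rcases h.nested.laminar _ hI T hT with h' | h' | h'
    · exact absurd h' hIT
    · refine Or.inr (or_iff_not_imp_right.2 fun hnd => ?_)
      obtain ⟨u, hu, huT⟩ := Finset.not_disjoint_iff.1 hnd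
      exact hC.subset_of_union (hsub T hT hIT h') (hC.1.2.union_of_mem (hconn T hT) hu huT)
    · exact Or.inr (Or.inr (h'.mono_left hCI))
  have hnadj : ∀ T ∈ 𝓘, Disjoint C T → ∀ u ∈ C, ∀ w ∈ T, ¬ G.Adj u w := by
    intro T hT hd u hu w hw hadj
    have hIT : ¬ smallestSet 𝓘 x ⊆ T := fun h' =>
      Finset.disjoint_left.1 hd hyC (h' (hCI hyC))
    rcases h.nested.laminar _ hI T hT with h' | h' | h'
    · exact hIT h'
    · exact Finset.disjoint_right.1 hd hw (hC.subset_of_union (hsub T hT hIT h')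
        (hC.1.2.union_of_adj (hconn T hT) hu hw hadj) hw)
    · exact h.nested.not_adj hI hT h' (hCI hu) hw hadj
  have hmem : C ∈ 𝓘 := by
    refine h.maximal C (Finset.subset_univ _) (IsNested.of_not_adj ?_ ?_ ?_)
    · intro S hS
      rcases Finset.mem_insert.1 hS with rfl | hS
      · exact hC.1.2
      · exact hconn S hS
    · intro S hS T hT
      rcases Finset.mem_insert.1 hS with rfl | hS' <;> rcases Finset.mem_insert.1 hT with rfl | hT'
      · exact Or.inl subset_rfl
      · exact hlam T hT'
      · rcases hlam S hS' with h' | h' | h'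
        · exact Or.inr (Or.inl h')
        · exact Or.inl h'
        · exact Or.inr (Or.inr h'.symm)
      · exact h.nested.laminar S hS' T hT'
    · intro S hS T hT hd u hu w hw
      rcases Finset.mem_insert.1 hS with rfl | hS' <;> rcases Finset.mem_insert.1 hT with rfl | hT'
      · exact absurd hu (Finset.disjoint_right.1 hd hu)
      · exact hnadj T hT' hd u hu w hw
      · exact fun hadj => hnadj S hS' hd.symm w hw u hu hadj.symm
      · exact h.nested.not_adj hS' hT' hd hu hw
  have hle : smallestSet 𝓘 x ⊆ C := hxy ▸ smallestSet_subset hmem hyC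
  exact Finset.notMem_erase x _ (hC.1.1 (hle hxI))

lemma IsMaximalNestedOn.nlt_iff (h : IsMaximalNestedOn G Finset.univ 𝓘) {u w : V} :
    NLT 𝓘 u w ↔ smallestSet 𝓘 u ⊂ smallestSet 𝓘 w := by
  constructor
  · rintro ⟨hne, hu⟩
    exact (smallestSet_subset (h.smallestSet_mem w) hu).ssubset_of_ne
      fun h' => hne (h.smallestSet_injective h')
  · intro hss
    exact ⟨fun h' => hss.ne (h' ▸ rfl), hss.subset (mem_smallestSet 𝓘 u)⟩

lemma IsMaximalNestedOn.topVertex_smallestSet [Nonempty V]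
    (h : IsMaximalNestedOn G Finset.univ 𝓘) (w : V) : topVertex 𝓘 (smallestSet 𝓘 w) = w := by
  have hw : IsTop 𝓘 (smallestSet 𝓘 w) w :=
    ⟨mem_smallestSet 𝓘 w, fun u hu => or_iff_not_imp_left.2 fun hne => ⟨hne, hu⟩⟩
  obtain ⟨h1, h2⟩ : IsTop 𝓘 (smallestSet 𝓘 w) (topVertex 𝓘 (smallestSet 𝓘 w)) :=
    Classical.epsilon_spec ⟨w, hw⟩
  rcases h2 w (mem_smallestSet 𝓘 w) with h' | h'
  · exact h'.symm
  · exact absurd (smallestSet_subset (h.smallestSet_mem w) h1) (h.nlt_iff.1 h').not_subset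

lemma IsMaximalNestedOn.mem_covered (h : IsMaximalNestedOn G Finset.univ 𝓘) {w b : V} :
    w ∈ covered 𝓘 b ↔ smallestSet 𝓘 w ⊂ smallestSet 𝓘 b ∧
      ∀ u, ¬ (smallestSet 𝓘 w ⊂ smallestSet 𝓘 u ∧ smallestSet 𝓘 u ⊂ smallestSet 𝓘 b) := by
  simp [covered, h.nlt_iff]

lemma IsMaximalNestedOn.disjoint_of_mem_covered (h : IsMaximalNestedOn G Finset.univ 𝓘)
    {b w w' : V} (hw : w ∈ covered 𝓘 b) (hw' : w' ∈ covered 𝓘 b) (hne : w ≠ w') :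
    Disjoint (smallestSet 𝓘 w) (smallestSet 𝓘 w') := by
  rw [h.mem_covered] at hw hw'
  have hI := h.smallestSet_injective.ne hne
  rcases h.nested.laminar _ (h.smallestSet_mem w) _ (h.smallestSet_mem w') with h' | h' | h'
  · exact absurd ⟨h'.ssubset_of_ne hI, hw'.1⟩ (hw.2 w')
  · exact absurd ⟨h'.ssubset_of_ne hI.symm, hw.1⟩ (hw'.2 w)
  · exact h'

/-- The sets `I_w`, for `w` covered by `b`, partition `I_b \ b`. -/
lemma IsMaximalNestedOn.biUnion_covered (h : IsMaximalNestedOn G Finset.univ 𝓘) (b : V) :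
    (covered 𝓘 b).biUnion (smallestSet 𝓘) = (smallestSet 𝓘 b).erase b := by
  ext u
  rw [Finset.mem_biUnion, Finset.mem_erase]
  constructor
  · rintro ⟨w, hw, hu⟩
    rw [h.mem_covered] at hw
    refine ⟨?_, hw.1.subset hu⟩
    rintro rfl
    exact hw.1.not_subset (smallestSet_subset (h.smallestSet_mem w) hu)
  · rintro ⟨hne, hu⟩
    have hlt := h.nlt_iff.1 ⟨hne, hu⟩
    obtain ⟨w, hw, hmax⟩ := Finset.exists_max_image (Finset.univ.filter fun w =>
      u ∈ smallestSet 𝓘 w ∧ smallestSet 𝓘 w ⊂ smallestSet 𝓘 b) (fun w => (smallestSet 𝓘 w).card)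
      ⟨u, Finset.mem_filter.2 ⟨Finset.mem_univ _, mem_smallestSet 𝓘 u, hlt⟩⟩
    rw [Finset.mem_filter] at hw
    refine ⟨w, h.mem_covered.2 ⟨hw.2.2, fun t ht => ?_⟩, hw.2.1⟩
    have := hmax t (Finset.mem_filter.2 ⟨Finset.mem_univ _, ht.1.subset hw.2.1, ht.2⟩)
    exact absurd (Finset.card_lt_card ht.1) (not_lt.2 this)

lemma IsMaximalNestedOn.Y_biUnion_of_subset_covered (h : IsMaximalNestedOn G Finset.univ 𝓘)
    (hG : G.IsAcyclic) {b : V} {s : Finset V} (hs : s ⊆ covered 𝓘 b) :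
    Y G (s.biUnion (smallestSet 𝓘)) = ∏ w ∈ s, Y G (smallestSet 𝓘 w) := by
  refine Y_biUnion hG s _ (fun i hi j hj => h.disjoint_of_mem_covered (hs hi) (hs hj)) ?_
  exact fun i hi j hj hij x hx y hy => h.nested.not_adj (h.smallestSet_mem i) (h.smallestSet_mem j)
    (h.disjoint_of_mem_covered (hs hi) (hs hj) hij) hx hy

end Nested

section Chain

variable {V : Type*} [DecidableEq V] {G : SimpleGraph V} {𝓘 : Finset (Finset V)}

/-! ### The chain of members containing a lower neighbour -/

lemma mem_chain {v a : V} {I : Finset V} : I ∈ chain 𝓘 v a ↔ I ∈ 𝓘 ∧ a ∈ I ∧ v ∉ I := by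
  simp [chain]

lemma IsNested.chain_total (h : IsNested G 𝓘) {v a : V} {I K : Finset V} (hI : I ∈ chain 𝓘 v a)
    (hK : K ∈ chain 𝓘 v a) : I ⊆ K ∨ K ⊆ I := by
  rw [mem_chain] at hI hK
  rcases h.laminar I hI.1 K hK.1 with h' | h' | h'
  · exact Or.inl h'
  · exact Or.inr h'
  · exact absurd hK.2.1 (Finset.disjoint_left.1 h' hI.2.1)

/-- The position of `I` in the chain, the largest set being the first one. -/
def chainRank (𝓘 : Finset (Finset V)) (v a : V) (I : Finset V) : ℕ :=
  ((chain 𝓘 v a).filter fun K => I ⊆ K).card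

lemma chainRank_lt {v a : V} {I K : Finset V} (hI : I ∈ chain 𝓘 v a) (hIK : I ⊂ K) :
    chainRank 𝓘 v a K < chainRank 𝓘 v a I := by
  refine Finset.card_lt_card ((Finset.ssubset_iff_of_subset fun T hT => ?_).2 ⟨I, ?_, ?_⟩)
  · rw [Finset.mem_filter] at hT ⊢
    exact ⟨hT.1, hIK.subset.trans hT.2⟩
  · exact Finset.mem_filter.2 ⟨hI, subset_rfl⟩
  · exact fun h => hIK.not_subset (Finset.mem_filter.1 h).2

lemma chainRank_mem_Icc {v a : V} {I : Finset V} (hI : I ∈ chain 𝓘 v a) :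
    chainRank 𝓘 v a I ∈ Finset.Icc 1 (chainLength 𝓘 v a) := by
  rw [Finset.mem_Icc]
  exact ⟨Finset.card_pos.2 ⟨I, Finset.mem_filter.2 ⟨hI, subset_rfl⟩⟩,
    Finset.card_le_card (Finset.filter_subset _ _)⟩

lemma IsNested.chainRank_injOn (h : IsNested G 𝓘) (v a : V) :
    Set.InjOn (chainRank 𝓘 v a) (chain 𝓘 v a : Set (Finset V)) := by
  intro I hI K hK hIK
  by_contra hne
  rcases h.chain_total hI hK with h' | h'
  · exact (chainRank_lt hI (h'.ssubset_of_ne hne)).ne' hIK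
  · exact (chainRank_lt hK (h'.ssubset_of_ne (Ne.symm hne))).ne hIK

lemma IsNested.chainSet_chainRank (h : IsNested G 𝓘) {v a : V} {I : Finset V}
    (hI : I ∈ chain 𝓘 v a) : chainSet 𝓘 v a (chainRank 𝓘 v a I) = I := by
  have : (chain 𝓘 v a).filter (fun K => chainRank 𝓘 v a K = chainRank 𝓘 v a I) = {I} := by
    ext K
    rw [Finset.mem_filter, Finset.mem_singleton]
    exact ⟨fun hK => h.chainRank_injOn v a hK.1 hI hK.2, fun hK => by rw [hK]; exact ⟨hI, rfl⟩⟩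
  have h2 : chainSet 𝓘 v a (chainRank 𝓘 v a I) =
    ((chain 𝓘 v a).filter fun K => chainRank 𝓘 v a K = chainRank 𝓘 v a I).biUnion id := rfl
  rw [h2, this, Finset.singleton_biUnion, id]

lemma IsNested.exists_chainRank_eq (h : IsNested G 𝓘) {v a : V} {j : ℕ} (h1 : 1 ≤ j)
    (h2 : j ≤ chainLength 𝓘 v a) :
    chainSet 𝓘 v a j ∈ chain 𝓘 v a ∧ chainRank 𝓘 v a (chainSet 𝓘 v a j) = j := by
  obtain ⟨I, hI, hIj⟩ := Finset.surjOn_of_injOn_of_card_le (chainRank 𝓘 v a)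
    (s := chain 𝓘 v a) (t := Finset.Icc 1 (chainLength 𝓘 v a)) (fun I hI => chainRank_mem_Icc hI)
    (h.chainRank_injOn v a) (by simp [chainLength]) (Finset.mem_coe.2 (Finset.mem_Icc.2 ⟨h1, h2⟩))
  rw [← hIj, h.chainSet_chainRank hI]
  exact ⟨hI, rfl⟩

lemma chainSet_eq_empty {v a : V} {j : ℕ} (hj : chainLength 𝓘 v a < j) :
    chainSet 𝓘 v a j = ∅ := by
  rw [chainSet, Finset.filter_eq_empty_iff.2, Finset.biUnion_empty]
  intro I hI hIj
  have := (Finset.mem_Icc.1 (chainRank_mem_Icc hI)).2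
  rw [chainRank, hIj] at this
  omega

lemma IsNested.chainSet_ssubset (h : IsNested G 𝓘) {v a : V} {j k : ℕ} (h1 : 1 ≤ j) (hjk : j < k)
    (h2 : k ≤ chainLength 𝓘 v a) : chainSet 𝓘 v a k ⊂ chainSet 𝓘 v a j := by
  obtain ⟨hj, hj'⟩ := h.exists_chainRank_eq (v := v) (a := a) h1 (by omega)
  obtain ⟨hk, hk'⟩ := h.exists_chainRank_eq (v := v) (a := a) (j := k) (by omega) h2
  have hne : chainSet 𝓘 v a k ≠ chainSet 𝓘 v a j := fun he => by rw [he, hj'] at hk'; omega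
  rcases h.chain_total hk hj with h' | h'
  · exact h'.ssubset_of_ne hne
  · have := chainRank_lt hj (h'.ssubset_of_ne hne.symm)
    omega

lemma IsNested.subset_chainSet_one (h : IsNested G 𝓘) {v a : V} {T : Finset V}
    (hT : T ∈ chain 𝓘 v a) : T ⊆ chainSet 𝓘 v a 1 := by
  have hr := Finset.mem_Icc.1 (chainRank_mem_Icc hT)
  rw [← h.chainSet_chainRank hT]
  rcases hr.1.eq_or_lt with h' | h'
  · rw [← h']
  · exact (h.chainSet_ssubset le_rfl h' hr.2).subset

lemma IsNested.chainSet_subset (h : IsNested G 𝓘) {v a : V} {T : Finset V}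
    (hT : T ∈ chain 𝓘 v a) : chainSet 𝓘 v a (chainLength 𝓘 v a) ⊆ T := by
  have hr := Finset.mem_Icc.1 (chainRank_mem_Icc hT)
  conv_rhs => rw [← h.chainSet_chainRank hT]
  rcases hr.2.eq_or_lt with h' | h'
  · rw [← h']
  · exact (h.chainSet_ssubset hr.1 h' le_rfl).subset

lemma IsNested.not_between_chainSet (h : IsNested G 𝓘) {v a : V} {j : ℕ} (h1 : 1 ≤ j)
    (h2 : j + 1 ≤ chainLength 𝓘 v a) {T : Finset V} (hT : T ∈ 𝓘)
    (hlt : chainSet 𝓘 v a (j + 1) ⊂ T) : ¬ T ⊂ chainSet 𝓘 v a j := by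
  intro hgt
  obtain ⟨hj, hj'⟩ := h.exists_chainRank_eq (v := v) (a := a) h1 (by omega)
  obtain ⟨hk, hk'⟩ := h.exists_chainRank_eq (v := v) (a := a) (j := j + 1) (by omega) h2
  have hTc : T ∈ chain 𝓘 v a := mem_chain.2
    ⟨hT, hlt.subset (mem_chain.1 hk).2.1, fun hv => (mem_chain.1 hj).2.2 (hgt.subset hv)⟩
  have := chainRank_lt hk hlt
  have := chainRank_lt hTc hgt
  omega

/-! ### The vertices below `v` -/

variable [Fintype V]

lemma IsMaximalNestedOn.mem_lowerNbrs (h : IsMaximalNestedOn G Finset.univ 𝓘) {v a : V} :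
    a ∈ lowerNbrs G 𝓘 v ↔ G.Adj v a ∧ smallestSet 𝓘 a ⊂ smallestSet 𝓘 v := by
  simp [lowerNbrs, h.nlt_iff]

lemma IsMaximalNestedOn.smallestSet_mem_chain (h : IsMaximalNestedOn G Finset.univ 𝓘) {v a : V}
    (ha : a ∈ lowerNbrs G 𝓘 v) : smallestSet 𝓘 a ∈ chain 𝓘 v a :=
  mem_chain.2 ⟨h.smallestSet_mem a, mem_smallestSet 𝓘 a, fun hv =>
    (h.mem_lowerNbrs.1 ha).2.not_subset (smallestSet_subset (h.smallestSet_mem a) hv)⟩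

lemma IsMaximalNestedOn.one_le_chainLength (h : IsMaximalNestedOn G Finset.univ 𝓘) {v a : V}
    (ha : a ∈ lowerNbrs G 𝓘 v) : 1 ≤ chainLength 𝓘 v a :=
  Finset.card_pos.2 ⟨_, h.smallestSet_mem_chain ha⟩

lemma IsMaximalNestedOn.chainSet_chainLength (h : IsMaximalNestedOn G Finset.univ 𝓘) {v a : V}
    (ha : a ∈ lowerNbrs G 𝓘 v) :
    chainSet 𝓘 v a (chainLength 𝓘 v a) = smallestSet 𝓘 a := by
  have hc := mem_chain.1
    (h.nested.exists_chainRank_eq (v := v) (a := a) (h.one_le_chainLength ha) le_rfl).1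
  exact (h.nested.chainSet_subset (h.smallestSet_mem_chain ha)).antisymm
    (smallestSet_subset hc.1 hc.2.1)

lemma IsMaximalNestedOn.chainSet_eq_smallestSet (h : IsMaximalNestedOn G Finset.univ 𝓘) {v a : V}
    {j : ℕ} (h1 : 1 ≤ j) (h2 : j ≤ chainLength 𝓘 v a) :
    smallestSet 𝓘 (chainVertex 𝓘 v a j) = chainSet 𝓘 v a j := by
  obtain ⟨w, hw⟩ := h.exists_smallestSet_eq
    (mem_chain.1 (h.nested.exists_chainRank_eq (v := v) (a := a) h1 h2).1).1
  have : Nonempty V := ⟨v⟩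
  rw [chainVertex, ← hw, h.topVertex_smallestSet]

lemma IsMaximalNestedOn.chain_disjoint (h : IsMaximalNestedOn G Finset.univ 𝓘) (hG : G.IsAcyclic)
    {v a b : V} (ha : G.Adj v a) (hb : G.Adj v b) (hne : a ≠ b) {S T : Finset V}
    (hS : S ∈ chain 𝓘 v a) (hT : T ∈ chain 𝓘 v b) : Disjoint S T := by
  rw [mem_chain] at hS hT
  rcases h.nested.laminar S hS.1 T hT.1 with h' | h' | h'
  · exact absurd ((h.nested.connected T hT.1).eq_of_adj hG hT.2.2 (h' hS.2.1) hT.2.1 ha hb) hne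
  · exact absurd ((h.nested.connected S hS.1).eq_of_adj hG hS.2.2 hS.2.1 (h' hT.2.1) ha hb) hne
  · exact h'

lemma IsMaximalNestedOn.chain_subset (h : IsMaximalNestedOn G Finset.univ 𝓘)
    {v a : V} (ha : a ∈ lowerNbrs G 𝓘 v) {T : Finset V} (hT : T ∈ chain 𝓘 v a) :
    T ⊆ smallestSet 𝓘 v := by
  rw [mem_chain] at hT
  rcases h.nested.laminar T hT.1 _ (h.smallestSet_mem v) with h' | h' | h'
  · exact h'
  · exact absurd (h' (mem_smallestSet 𝓘 v)) hT.2.2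
  · exact absurd ((h.mem_lowerNbrs.1 ha).2.subset (mem_smallestSet 𝓘 a))
      (Finset.disjoint_left.1 h' hT.2.1)

/-- Every component of `I_v \ v` contains a neighbour of `v`, because `I_v` is connected. -/
lemma IsMaximalNestedOn.exists_adj_of_mem_covered (h : IsMaximalNestedOn G Finset.univ 𝓘)
    {v w : V} (hw : w ∈ covered 𝓘 v) : ∃ a ∈ smallestSet 𝓘 w, G.Adj v a := by
  have hss := (h.mem_covered.1 hw).1
  have hvw : v ∉ smallestSet 𝓘 w := fun hv =>
    hss.not_subset (smallestSet_subset (h.smallestSet_mem w) hv)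
  obtain ⟨x, -, y, hy, hx, hyw, hadj⟩ := (h.nested.connected _ (h.smallestSet_mem v)).exists_adj
    (hss.subset (mem_smallestSet 𝓘 w)) (mem_smallestSet 𝓘 w) (mem_smallestSet 𝓘 v) hvw
  refine ⟨x, hx, ?_⟩
  by_cases hyv : y = v
  · exact hyv ▸ hadj.symm
  have hmem : y ∈ (covered 𝓘 v).biUnion (smallestSet 𝓘) := by
    rw [h.biUnion_covered]
    exact Finset.mem_erase.2 ⟨hyv, hy⟩
  obtain ⟨w', hw', hyw'⟩ := Finset.mem_biUnion.1 hmem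
  have hne : w ≠ w' := by rintro rfl; exact hyw hyw'
  exact absurd hadj (h.nested.not_adj (h.smallestSet_mem w) (h.smallestSet_mem w')
    (h.disjoint_of_mem_covered hw hw' hne) hx hyw')

lemma IsMaximalNestedOn.setJ_one (h : IsMaximalNestedOn G Finset.univ 𝓘) (v : V) :
    setJ G 𝓘 v (fun _ => 1) = smallestSet 𝓘 v := by
  have hv := mem_smallestSet 𝓘 v
  apply Finset.Subset.antisymm
  · refine Finset.union_subset (by simpa using hv) (Finset.biUnion_subset.2 fun a ha => ?_)
    exact h.chain_subset ha (h.nested.exists_chainRank_eq le_rfl (h.one_le_chainLength ha)).1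
  · intro u hu
    rw [setJ, Finset.mem_union, Finset.mem_singleton]
    refine or_iff_not_imp_left.2 fun huv => ?_
    have hmem : u ∈ (covered 𝓘 v).biUnion (smallestSet 𝓘) := by
      rw [h.biUnion_covered]
      exact Finset.mem_erase.2 ⟨huv, hu⟩
    obtain ⟨w, hw, huw⟩ := Finset.mem_biUnion.1 hmem
    obtain ⟨a, haw, hadj⟩ := h.exists_adj_of_mem_covered hw
    have hss := (h.mem_covered.1 hw).1
    refine Finset.mem_biUnion.2 ⟨a, h.mem_lowerNbrs.2 ⟨hadj,
      (smallestSet_subset (h.smallestSet_mem w) haw).trans_ssubset hss⟩, ?_⟩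
    exact h.nested.subset_chainSet_one (mem_chain.2 ⟨h.smallestSet_mem w, haw, fun hv' =>
      hss.not_subset (smallestSet_subset (h.smallestSet_mem w) hv')⟩) huw

/-! ### Telescoping along a chain -/

lemma pathSet_eq_of_isPath (hG : G.IsAcyclic) {x y : V} (p : G.Walk x y) (hp : p.IsPath) :
    pathSet G x y = p.support.toFinset := by
  ext z
  simp only [pathSet, Finset.mem_filter, Finset.mem_univ, true_and, List.mem_toFinset]
  refine ⟨?_, fun hz => ⟨p, hp, hz⟩⟩
  rintro ⟨r, hr, hz⟩
  have hrp : r = p := congrArg Subtype.val ((hG.subsingleton_path x y).elim ⟨r, hr⟩ ⟨p, hp⟩)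
  exact hrp ▸ hz

/-- The ratio `Y_{S \ a} / Y_S`, with value `0` when `a` does not lie in `S`. -/
noncomputable def deletionRatio (G : SimpleGraph V) (S : Finset V) (a : V) : AmbientField V :=
  if a ∈ S then Y G (S.erase a) / Y G S else 0

/-- The coefficient `A_j` measures how the deletion ratio drops from one chain set to the next. For
consecutive sets `K ⊂ I` with `b` the top vertex of `I`, let `R` be the rest of `I \ b`. Then
`Y_{I \ b} = Y_R Y_K`, and the continuant identity for the path from `a` to `b` in `I` gives
`Y_{I \ a} Y_K - Y_I Y_{K \ a} = Y_R Y_{K \ [a, b]} ^ 2`. -/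
lemma IsMaximalNestedOn.deletionRatio_sub (h : IsMaximalNestedOn G Finset.univ 𝓘)
    (hG : G.IsAcyclic) {v a : V} (ha : a ∈ lowerNbrs G 𝓘 v) {j : ℕ} (h1 : 1 ≤ j)
    (h2 : j ≤ chainLength 𝓘 v a) :
    deletionRatio G (chainSet 𝓘 v a j) a - deletionRatio G (chainSet 𝓘 v a (j + 1)) a =
      chainCoeff G 𝓘 v a j / (Y G (chainSet 𝓘 v a j) * Y G (chainSet 𝓘 v a (j + 1))) := by
  have hI := (h.nested.exists_chainRank_eq (v := v) (a := a) h1 h2).1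
  have hb := h.chainSet_eq_smallestSet h1 h2
  rw [mem_chain] at hI
  rcases h2.lt_or_eq with hlt | rfl
  · have hK := (h.nested.exists_chainRank_eq (v := v) (a := a) (j := j + 1) (by omega) hlt).1
    have hc := h.chainSet_eq_smallestSet (v := v) (a := a) (j := j + 1) (by omega) hlt
    rw [mem_chain] at hK
    rw [chainCoeff, if_pos hlt]
    have hKI := h.nested.chainSet_ssubset (v := v) (a := a) h1 (Nat.lt_succ_self j) hlt
    have hbet := fun T hT => h.nested.not_between_chainSet (v := v) (a := a) h1 hlt (T := T) hT
    set I := chainSet 𝓘 v a j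
    set K := chainSet 𝓘 v a (j + 1)
    set b := chainVertex 𝓘 v a j
    set c := chainVertex 𝓘 v a (j + 1)
    have hbK : b ∉ K := fun hbK => hKI.not_subset (hb ▸ smallestSet_subset hK.1 hbK)
    have hbI : b ∈ I := hb ▸ mem_smallestSet 𝓘 b
    have hcov : c ∈ covered 𝓘 b := by
      rw [h.mem_covered, hb, hc]
      exact ⟨hKI, fun u hu => hbet _ (h.smallestSet_mem u) hu.1 hu.2⟩
    -- The rest `R` of `I \ b` outside `K`.
    set R := (covered 𝓘 b \ {c}).biUnion (smallestSet 𝓘) with hR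
    have hYR := h.Y_biUnion_of_subset_covered hG (Finset.sdiff_subset (s := covered 𝓘 b) (t := {c}))
    rw [← hR] at hYR
    rw [← hYR]
    have hRK : I.erase b = R ∪ K := by
      rw [← hb, ← h.biUnion_covered b, ← hc, hR]
      conv_lhs => rw [← Finset.sdiff_union_of_subset (Finset.singleton_subset_iff.2 hcov)]
      rw [Finset.union_biUnion, Finset.singleton_biUnion]
    have hRd : Disjoint R K := by
      rw [hR, Finset.disjoint_biUnion_left]
      intro w hw
      rw [Finset.mem_sdiff, Finset.mem_singleton] at hw
      exact hc ▸ h.disjoint_of_mem_covered hw.1 hcov hw.2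
    have hRn : ∀ x ∈ R, ∀ y ∈ K, ¬ G.Adj x y := by
      intro x hx y hy
      obtain ⟨w, hw, hxw⟩ := Finset.mem_biUnion.1 hx
      rw [Finset.mem_sdiff, Finset.mem_singleton] at hw
      exact h.nested.not_adj (h.smallestSet_mem w) hK.1
        (hc ▸ h.disjoint_of_mem_covered hw.1 hcov hw.2) hxw hy
    have hmul : ∀ T ⊆ K, Y G (R ∪ T) = Y G R * Y G T := fun T hT =>
      Y_union hG (hRd.mono_right hT) fun x hx y hy => hRn x hx y (hT hy)
    have hab : a ≠ b := fun hab => hbK (hab ▸ hK.2.1)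
    have haR : a ∉ R := fun h' => Finset.disjoint_left.1 hRd h' hK.2.1
    -- A path from `a` to `b` that stays in `K` up to its last step.
    obtain ⟨d, hd, hdb⟩ := h.exists_adj_of_mem_covered hcov
    rw [hc] at hd
    obtain ⟨q, hq⟩ := (h.nested.connected K hK.1).exists_walk hd hK.2.1
    have hqK : ∀ z ∈ q.bypass.support, z ∈ K := fun z hz =>
      hq z (q.support_bypass_subset_support hz)
    let p : G.Walk b a := .cons hdb q.bypass
    have hp : p.IsPath := (SimpleGraph.Walk.cons_isPath_iff _ _).2
      ⟨q.bypass_isPath, fun hz => hbK (hqK b hz)⟩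
    have hpsupp : ∀ z, z ∈ p.support ↔ z = b ∨ z ∈ q.bypass.support := fun z => by
      simp [p]
    have hpI : ∀ z ∈ p.support, z ∈ I := fun z hz => by
      rcases (hpsupp z).1 hz with rfl | hz
      · exact hbI
      · exact hKI.subset (hqK z hz)
    have hpath := minorDiff_of_isPath hG p hp hpI
    rw [minorDiff, if_neg hab.symm, hRK, Finset.erase_union_distrib,
      Finset.erase_eq_of_notMem haR, hmul K subset_rfl, hmul _ (Finset.erase_subset _ _)] at hpath
    have hset : K \ pathSet G v b = K \ p.support.toFinset := by
      have hvp : v ∉ p.reverse.support := fun hv => hI.2.2 (hpI v (by simpa using hv))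
      have hP : (SimpleGraph.Walk.cons (h.mem_lowerNbrs.1 ha).1 p.reverse).IsPath :=
        (SimpleGraph.Walk.cons_isPath_iff _ _).2 ⟨hp.reverse, hvp⟩
      rw [pathSet_eq_of_isPath hG _ hP, SimpleGraph.Walk.support_cons,
        SimpleGraph.Walk.support_reverse, List.toFinset_cons, List.toFinset_reverse,
        Finset.sdiff_insert_of_notMem hK.2.2]
    have hset2 : I \ p.support.toFinset = R ∪ (K \ p.support.toFinset) := by
      have hRp : R \ p.support.toFinset = R := by
        refine Finset.sdiff_eq_self_of_disjoint (Finset.disjoint_left.2 fun z hz hzp => ?_)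
        rcases (hpsupp z).1 (List.mem_toFinset.1 hzp) with rfl | hzq
        · exact Finset.notMem_erase _ I (hRK ▸ Finset.mem_union_left K hz)
        · exact Finset.disjoint_left.1 hRd hz (hqK z hzq)
      rw [← Finset.insert_erase hbI,
        Finset.insert_sdiff_of_mem _ (List.mem_toFinset.2 p.start_mem_support), hRK,
        Finset.union_sdiff_distrib, hRp]
    rw [hset2, hmul _ Finset.sdiff_subset, mul_pow, ← hset] at hpath
    have hYR0 := Y_ne_zero G R
    have hYI := Y_ne_zero G I
    have hYK := Y_ne_zero G K
    rw [deletionRatio, deletionRatio, if_pos hI.2.1, if_pos hK.2.1, div_sub_div _ _ hYI hYK]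
    congr 1
    refine mul_left_cancel₀ hYR0 ?_
    linear_combination hpath
  · have hba : chainVertex 𝓘 v a (chainLength 𝓘 v a) = a :=
      h.smallestSet_injective (hb.trans (h.chainSet_chainLength ha))
    rw [chainCoeff, if_neg (lt_irrefl _), hba, chainSet_eq_empty (Nat.lt_succ_self _),
      h.chainSet_chainLength ha, ← h.Y_biUnion_of_subset_covered hG subset_rfl,
      h.biUnion_covered, deletionRatio, deletionRatio, if_pos (mem_smallestSet 𝓘 a)]
    simp

lemma IsMaximalNestedOn.sum_chainCoeff (h : IsMaximalNestedOn G Finset.univ 𝓘)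
    (hG : G.IsAcyclic) {v a : V} (ha : a ∈ lowerNbrs G 𝓘 v) {n : ℕ}
    (hn : n ≤ chainLength 𝓘 v a) :
    ∑ j ∈ Finset.Icc 1 n, chainCoeff G 𝓘 v a j /
        (Y G (chainSet 𝓘 v a j) * Y G (chainSet 𝓘 v a (j + 1))) =
      deletionRatio G (chainSet 𝓘 v a 1) a - deletionRatio G (chainSet 𝓘 v a (n + 1)) a := by
  induction n with
  | zero => simp
  | succ n ih =>
    rw [Finset.sum_Icc_succ_top (by omega), ih (by omega),
      ← h.deletionRatio_sub hG ha (by omega) hn, sub_add_sub_cancel]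

/-! ### Expansion at `v` -/

lemma IsMaximalNestedOn.notMem_chainSet (h : IsMaximalNestedOn G Finset.univ 𝓘) {v a : V} {j : ℕ}
    (h1 : 1 ≤ j) : v ∉ chainSet 𝓘 v a j := by
  rcases le_or_gt j (chainLength 𝓘 v a) with h2 | h2
  · exact (mem_chain.1 (h.nested.exists_chainRank_eq h1 h2).1).2.2
  · simp [chainSet_eq_empty h2]

lemma IsMaximalNestedOn.setJ_erase (h : IsMaximalNestedOn G Finset.univ 𝓘) {v : V} {m : V → ℕ}
    (hm : ∀ a ∈ lowerNbrs G 𝓘 v, 1 ≤ m a) :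
    (setJ G 𝓘 v m).erase v = (lowerNbrs G 𝓘 v).biUnion fun a => chainSet 𝓘 v a (m a) := by
  have hv : v ∉ (lowerNbrs G 𝓘 v).biUnion fun a => chainSet 𝓘 v a (m a) := by
    simp only [Finset.mem_biUnion, not_exists, not_and]
    exact fun a ha => h.notMem_chainSet (hm a ha)
  rw [setJ, Finset.erase_union_distrib, Finset.erase_eq_of_notMem hv]
  simp

/-- The sets `I^a_{m_a}`, for different lower neighbours `a` of `v`, are separated by `v`, so that
deleting vertices from them changes the corresponding factors of `Y` independently. -/
lemma IsMaximalNestedOn.Y_biUnion_subset_chainSet (h : IsMaximalNestedOn G Finset.univ 𝓘)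
    (hG : G.IsAcyclic) {v : V} {m : V → ℕ} (hm : ∀ a ∈ lowerNbrs G 𝓘 v, 1 ≤ m a) (B : V → Finset V)
    (hB : ∀ a, B a ⊆ chainSet 𝓘 v a (m a)) :
    Y G ((lowerNbrs G 𝓘 v).biUnion B) = ∏ a ∈ lowerNbrs G 𝓘 v, Y G (B a) := by
  have key : ∀ a ∈ lowerNbrs G 𝓘 v, ∀ x ∈ B a,
      chainSet 𝓘 v a (m a) ∈ chain 𝓘 v a := by
    intro a ha x hx
    rcases le_or_gt (m a) (chainLength 𝓘 v a) with h2 | h2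
    · exact (h.nested.exists_chainRank_eq (hm a ha) h2).1
    · exact absurd (hB a hx) (by simp [chainSet_eq_empty h2])
  refine Y_biUnion hG _ B ?_ ?_
  · intro a ha b hb hab
    refine Finset.disjoint_left.2 fun x hxa hxb => ?_
    exact Finset.disjoint_left.1 (h.chain_disjoint hG (h.mem_lowerNbrs.1 ha).1
      (h.mem_lowerNbrs.1 hb).1 hab (key a ha x hxa) (key b hb x hxb)) (hB a hxa) (hB b hxb)
  · intro a ha b hb hab x hxa y hyb
    have h1 := key a ha x hxa
    have h2 := key b hb y hyb
    exact h.nested.not_adj (mem_chain.1 h1).1 (mem_chain.1 h2).1 (h.chain_disjoint hG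
      (h.mem_lowerNbrs.1 ha).1 (h.mem_lowerNbrs.1 hb).1 hab h1 h2) (hB a hxa) (hB b hyb)

lemma IsMaximalNestedOn.Y_setJ (h : IsMaximalNestedOn G Finset.univ 𝓘) (hG : G.IsAcyclic) {v : V}
    {m : V → ℕ} (hm : ∀ a ∈ lowerNbrs G 𝓘 v, 1 ≤ m a) :
    Y G (setJ G 𝓘 v m) = Y G ((setJ G 𝓘 v m).erase v) *
      (Y G {v} - ∑ a ∈ lowerNbrs G 𝓘 v, deletionRatio G (chainSet 𝓘 v a (m a)) a) := by
  classical
  have hv : v ∈ setJ G 𝓘 v m := by simp [setJ]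
  have hYe := h.Y_biUnion_subset_chainSet hG hm (fun a => chainSet 𝓘 v a (m a)) fun a => subset_rfl
  rw [Y_eq_sub hG hv, mul_sub, mul_comm (Y G {v}), h.setJ_erase hm, Finset.mul_sum]
  congr 1
  -- The neighbours of `v` in this set are the lower neighbours `a` whose chain set is nonempty.
  have hnbr : (((lowerNbrs G 𝓘 v).biUnion fun a => chainSet 𝓘 v a (m a)).filter
      fun a => G.Adj v a) = (lowerNbrs G 𝓘 v).filter fun a => a ∈ chainSet 𝓘 v a (m a) := by
    ext x
    simp only [Finset.mem_filter, Finset.mem_biUnion]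
    constructor
    · rintro ⟨⟨a, ha, hx⟩, hadj⟩
      rcases le_or_gt (m a) (chainLength 𝓘 v a) with h2 | h2
      · have hc := mem_chain.1 (h.nested.exists_chainRank_eq (v := v) (a := a) (hm a ha) h2).1
        obtain rfl := (h.nested.connected _ hc.1).eq_of_adj hG hc.2.2 hx hc.2.1 hadj
          (h.mem_lowerNbrs.1 ha).1
        exact ⟨ha, hx⟩
      · simp [chainSet_eq_empty h2] at hx
    · rintro ⟨ha, hx⟩
      exact ⟨⟨x, ha, hx⟩, (h.mem_lowerNbrs.1 ha).1⟩
  rw [hnbr, Finset.sum_filter]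
  refine Finset.sum_congr rfl fun a ha => ?_
  rw [deletionRatio]
  split_ifs with hmem
  · have hset : ((lowerNbrs G 𝓘 v).biUnion fun b => chainSet 𝓘 v b (m b)).erase a =
        (lowerNbrs G 𝓘 v).biUnion fun b => (chainSet 𝓘 v b (m b)).erase a := by
      ext x
      simp only [Finset.mem_erase, Finset.mem_biUnion]
      tauto
    have hother : ∀ b ∈ (lowerNbrs G 𝓘 v).erase a, (chainSet 𝓘 v b (m b)).erase a =
        chainSet 𝓘 v b (m b) := by
      intro b hb
      rw [Finset.mem_erase] at hb
      refine Finset.erase_eq_of_notMem fun hab => ?_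
      rcases le_or_gt (m b) (chainLength 𝓘 v b) with h2 | h2
      · have hc := mem_chain.1 (h.nested.exists_chainRank_eq (v := v) (a := b) (hm b hb.2) h2).1
        exact hb.1 ((h.nested.connected _ hc.1).eq_of_adj hG hc.2.2 hab hc.2.1
          (h.mem_lowerNbrs.1 ha).1 (h.mem_lowerNbrs.1 hb.2).1).symm
      · simp [chainSet_eq_empty h2] at hab
    rw [hset, h.Y_biUnion_subset_chainSet hG hm (fun b => (chainSet 𝓘 v b (m b)).erase a)
      (fun b => Finset.erase_subset _ _), hYe, ← Finset.mul_prod_erase _ _ ha,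
      ← Finset.mul_prod_erase _ (fun b => Y G (chainSet 𝓘 v b (m b))) ha,
      Finset.prod_congr rfl fun b hb => by rw [hother b hb]]
    have := Y_ne_zero G (chainSet 𝓘 v a (m a))
    field_simp
  · rw [mul_zero]

/-- The expansion of `Y_{I_v}` at `v`, solved for `Y_v`. -/
lemma IsMaximalNestedOn.Y_smallestSet_div (h : IsMaximalNestedOn G Finset.univ 𝓘)
    (hG : G.IsAcyclic) (v : V) :
    Y G (smallestSet 𝓘 v) / ∏ a ∈ lowerNbrs G 𝓘 v, Y G (chainSet 𝓘 v a 1) =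
      Y G {v} - ∑ a ∈ lowerNbrs G 𝓘 v, deletionRatio G (chainSet 𝓘 v a 1) a := by
  have h1 := h.Y_setJ hG (v := v) (m := fun _ => 1) fun _ _ => le_rfl
  have h2 : Y G ((setJ G 𝓘 v fun _ => 1).erase v) =
      ∏ a ∈ lowerNbrs G 𝓘 v, Y G (chainSet 𝓘 v a 1) := by
    rw [h.setJ_erase fun _ _ => le_rfl]
    exact h.Y_biUnion_subset_chainSet hG (m := fun _ => 1) (fun _ _ => le_rfl) _ fun _ => subset_rfl
  rw [h2, h.setJ_one] at h1
  rw [h1, mul_div_cancel_left₀]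
  exact Finset.prod_ne_zero_iff.2 fun a _ => Y_ne_zero G _

end Chain

end GraphLP

theorem proposition7p1 {V : Type*} [Fintype V] [DecidableEq V] (G : SimpleGraph V)
    (hG : G.IsTree) (𝓘 : Finset (Finset V))
    (h𝓘 : GraphLP.IsMaximalNestedOn G Finset.univ 𝓘) (v : V) :
    (∀ m : V → ℕ,
      (∀ a ∈ GraphLP.lowerNbrs G 𝓘 v, 1 ≤ m a ∧ m a ≤ GraphLP.chainLength 𝓘 v a + 1) →
      GraphLP.Y G (GraphLP.setJ G 𝓘 v m) =
        GraphLP.Y G (GraphLP.setJ G 𝓘 v m \ {v}) *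
          (GraphLP.Y G (GraphLP.smallestSet 𝓘 v) /
              (∏ a ∈ GraphLP.lowerNbrs G 𝓘 v, GraphLP.Y G (GraphLP.chainSet 𝓘 v a 1)) +
            ∑ a ∈ GraphLP.lowerNbrs G 𝓘 v, ∑ j ∈ Finset.Icc 1 (m a - 1),
              GraphLP.chainCoeff G 𝓘 v a j /
                (GraphLP.Y G (GraphLP.chainSet 𝓘 v a j) *
                  GraphLP.Y G (GraphLP.chainSet 𝓘 v a (j + 1))))) ∧
    GraphLP.Y G {v} =
      GraphLP.Y G (GraphLP.smallestSet 𝓘 v) /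
          (∏ a ∈ GraphLP.lowerNbrs G 𝓘 v, GraphLP.Y G (GraphLP.chainSet 𝓘 v a 1)) +
        ∑ a ∈ GraphLP.lowerNbrs G 𝓘 v, ∑ j ∈ Finset.Icc 1 (GraphLP.chainLength 𝓘 v a),
          GraphLP.chainCoeff G 𝓘 v a j /
            (GraphLP.Y G (GraphLP.chainSet 𝓘 v a j) *
              GraphLP.Y G (GraphLP.chainSet 𝓘 v a (j + 1))) := by
  have hac := hG.isAcyclic
  rw [h𝓘.Y_smallestSet_div hac]
  constructor
  · intro m hm
    rw [h𝓘.Y_setJ hac fun a ha => (hm a ha).1, Finset.erase_eq]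
    congr 1
    rw [sub_add, ← Finset.sum_sub_distrib]
    congr 1
    refine Finset.sum_congr rfl fun a ha => ?_
    obtain ⟨h1, h2⟩ := hm a ha
    rw [h𝓘.sum_chainCoeff hac ha (n := m a - 1) (by omega), Nat.sub_add_cancel h1, sub_sub_cancel]
  · rw [sub_add, ← Finset.sum_sub_distrib, Finset.sum_eq_zero, sub_zero]
    intro a ha
    rw [h𝓘.sum_chainCoeff hac ha le_rfl, GraphLP.chainSet_eq_empty (Nat.lt_succ_self _)]
    simp [GraphLP.deletionRatio]
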